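/- **Setting.** A binary-input output-symmetric (BIOS) memoryless channel has input alphabet $\mathbb F_2$, an output alphabet $\mathcal Y$ (discrete or continuous) and transition probabilities given by densities $P(y|0),P(y|1)$ with respect to a $\sigma$-finite reference measure $\mu$ on $\mathcal Y$ (counting measure in the discrete case, e.g. Lebesgue measure in the continuous case), such that $P(y|1)=P(\pi(y)|0)$ for all $y$, for some $\mu$-preserving map $\pi:\mathcal Y\to\mathcal Y$ with $\pi(\pi(y))=y$. For $n$ uses, $P(\boldsymbol y|\boldsymbol x)=\prod_{i=0}^{n-1}P(y_i|x_i)$. Its capacity, in bits per channel use, is $$C_{\rm BIOS}=I(X;Y)=\frac12\sum_{x\in\mathbb F_2}\int_{\mathcal Y}P(y|x)\log_2\frac{P(y|x)}{\frac12P(y|0)+\frac12P(y|1)}\,d\mu(y)$$ ($X$ uniform on $\mathbb F_2$). A *profile* of length $n$ is a $k$-tuple $\boldsymbol w=(w_0,\dots,w_{k-1})$ of positive integers with $\sum_\ell w_\ell=n$. A *staircase generator matrix* with profile $\boldsymbol w$ is a binary $k\times n$ matrix $\mathbf G$ whose $\ell$-th row is $(\boldsymbol h_\ell,\boldsymbol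 i_\ell,\boldsymbol j_\ell)$, where $\boldsymbol h_\ell$ is an arbitrary binary sequence of length $\sum_{i<\ell}w_i$, $\boldsymbol i_\ell$ is the all-one sequence of length $w_\ell$ and $\boldsymbol j_\ell$ is the all-zero sequence of length $n-\sum_{i\le \ell}w_i$. The *random staircase generator matrix code* with profile $\boldsymbol w$ has all entries of the $\boldsymbol h_\ell$ chosen as independent fair bits. A message $\boldsymbol U$, uniform on $\mathbb F_2^k$, is sent as the codeword $\boldsymbol U\mathbf G$; a maximum-likelihood (ML) decoder maps each received $\boldsymbol y$ to a message $\hat{\boldsymbol U}$ maximizing $P(\boldsymbol y|\boldsymbol u\mathbf G)$ over $\boldsymbol u\in\mathbb F_2^k$, ties being broken arbitrarily; ${\rm FER}=\Pr\{\hat{\boldsymbol U}\ne\boldsymbol U\}$. **Theorem 2.** Consider a BIOS memoryless channel. For every $\epsilon>0$ and every $\delta$ with $0<\delta<C_{\rm BIOS}$ there is an integer $n_T$ such that for all $n\ge n_T$ and $k=\lceil n(C_{\rm BIOS}-\delta)\rceil$ one has $0<k<n$ and $C_{\rm BIOS}-\delta\le k/n<C_{\rm BIOS}$, and there is a profile $\boldsymbol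 w=(w_0,\dots,w_{k-1})$ of length $n$ such that 1. there exists a staircase generator matrix $\mathbf G$ with profile $\boldsymbol w$ whose frame error rate under ML decoding (with any tie-breaking) satisfies ${\rm FER}\le\epsilon$; and 2. the average of the ML frame error rate over the random staircase generator matrix code with profile $\boldsymbol w$ is at most $\epsilon$ (with any tie-breaking). In other words, random staircase generator matrix codes achieve the capacity of BIOS memoryless channels. -/

import Mathlib

open MeasureTheory
open scoped NNReal ENNReal

noncomputable section

/-- A binary-input output-symmetric (BIOS) channel with output alphabet `Y`. The transition
probabilities are given by densities `p x` with respect to a σ-finite reference measure `μ`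
(counting measure for a discrete channel, Lebesgue measure for a continuous one).
Symmetry is with respect to an involution `π` of the output alphabet that preserves `μ`
(for the counting measure every involution does). -/
structure BIOSChannel (Y : Type*) [MeasurableSpace Y] where
  /-- the reference measure -/
  μ : Measure Y
  sigmaFinite : SigmaFinite μ
  /-- `p x y` is the transition probability (density) `P(y | x)` -/
  p : ZMod 2 → Y → ℝ≥0
  measurable_p : ∀ x, Measurable (p x)
  lintegral_p : ∀ x, ∫⁻ y, (p x y : ℝ≥0∞) ∂μ = 1
  /-- the symmetry of the output alphabet -/
  π : Y → Y
  involutive_π : Function.Involutive π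
  measurePreserving_π : MeasurePreserving π μ μ
  symm : ∀ y, p 1 y = p 0 (π y)

namespace BIOSChannel

variable {Y : Type*} [MeasurableSpace Y] (W : BIOSChannel Y)

/-- The output density `P(y) = (1 - r) P(y|0) + r P(y|1)` for the input law `P(1) = r`. -/
def outputDensity (r : ℝ) (y : Y) : ℝ :=
  (1 - r) * (W.p 0 y : ℝ) + r * (W.p 1 y : ℝ)

/-- The partial mutual information `I_x(r) = ∑_y P(y|x) log (P(y|x) / P(y))`, in bits.
At a point with `P(y|x) = 0` the integrand is `0`. -/
def partialMutualInfo (x : ZMod 2) (r : ℝ) : ℝ :=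
  ∫ y, (W.p x y : ℝ) * Real.logb 2 ((W.p x y : ℝ) / W.outputDensity r y) ∂W.μ

/-- The mutual information `I(X; Y)`, in bits, for the input law `P(1) = r`, `P(0) = 1 - r`. -/
def mutualInfo (r : ℝ) : ℝ :=
  (1 - r) * W.partialMutualInfo 0 r + r * W.partialMutualInfo 1 r

/-- The capacity of a BIOS channel: `I(X; Y)` for a uniform input, in bits per channel use. -/
def capacity : ℝ := W.mutualInfo (1 / 2)

/-- The law of the channel output when the symbol `x` is sent. -/
def law (x : ZMod 2) : Measure Y := W.μ.withDensity fun y => (W.p x y : ℝ≥0∞)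

/-- The law of the output sequence when the word `c` is sent (memoryless channel). -/
def wordLaw {n : ℕ} (c : Fin n → ZMod 2) : Measure (Fin n → Y) :=
  Measure.pi fun i => W.law (c i)

/-- The likelihood `P(y | c) = ∏ᵢ P(yᵢ | cᵢ)`. -/
def likelihood {n : ℕ} (c : Fin n → ZMod 2) (y : Fin n → Y) : ℝ≥0 :=
  ∏ i, W.p (c i) (y i)

/-- `dec` is a maximum-likelihood decoder for the code with generator matrix `G`, where the
message `u` is encoded as `u G`: for every received `y` it outputs a message of maximal
likelihood. Ties may be broken in any way. -/
def IsMLDecoder {k n : ℕ} (G : Matrix (Fin k) (Fin n) (ZMod 2))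
    (dec : (Fin n → Y) → (Fin k → ZMod 2)) : Prop :=
  ∀ (y : Fin n → Y) (u : Fin k → ZMod 2),
    W.likelihood (Matrix.vecMul u G) y ≤ W.likelihood (Matrix.vecMul (dec y) G) y

/-- The frame error rate `Pr{Û ≠ U}` for a message `U` uniform on `𝔽₂ᵏ`. -/
def FER {k n : ℕ} (G : Matrix (Fin k) (Fin n) (ZMod 2))
    (dec : (Fin n → Y) → (Fin k → ZMod 2)) : ℝ :=
  (∑ u : Fin k → ZMod 2, (W.wordLaw (Matrix.vecMul u G)).real {y | dec y ≠ u}) / 2 ^ k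

end BIOSChannel

/-- `w` is a profile of length `n`: positive widths `w₀, …, w_{k-1}` with sum `n`. -/
def IsProfile {k : ℕ} (n : ℕ) (w : Fin k → ℕ) : Prop :=
  (∀ l, 0 < w l) ∧ ∑ l, w l = n

/-- The column at which the `l`-th staircase starts, `w₀ + ⋯ + w_{l-1}`. -/
def stairStart {k : ℕ} (w : Fin k → ℕ) (l : Fin k) : ℕ := ∑ i ∈ Finset.univ.filter (· < l), w i

/-- `G` is a staircase matrix with widths `w`: row `l` is arbitrary before column
`stairStart w l`, then has `w l` ones, then zeros. -/
def IsStaircase {k n : ℕ} (w : Fin k → ℕ) (G : Matrix (Fin k) (Fin n) (ZMod 2)) : Prop :=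
  ∀ (l : Fin k) (j : Fin n),
    (stairStart w l ≤ (j : ℕ) → (j : ℕ) < stairStart w l + w l → G l j = 1) ∧
    (stairStart w l + w l ≤ (j : ℕ) → G l j = 0)

open Classical in
/-- The support of the random staircase ensemble with widths `w`. Choosing the entries to the
left of the staircase as independent fair bits is choosing a uniform element of this set. -/
def staircaseEnsemble {k : ℕ} (n : ℕ) (w : Fin k → ℕ) :
    Finset (Matrix (Fin k) (Fin n) (ZMod 2)) :=
  Finset.univ.filter fun G => IsStaircase w G

/-- The average frame error rate of the random staircase ensemble with widths `w`, where the
code with generator matrix `G` is decoded by `dec G`. -/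
def BIOSChannel.avgFER {Y : Type*} [MeasurableSpace Y] (W : BIOSChannel Y) {k n : ℕ}
    (w : Fin k → ℕ)
    (dec : Matrix (Fin k) (Fin n) (ZMod 2) → (Fin n → Y) → (Fin k → ZMod 2)) : ℝ :=
  (∑ G ∈ staircaseEnsemble n w, W.FER G (dec G)) / ((staircaseEnsemble n w).card : ℝ)

end

/-! By channel symmetry the zero codeword may be assumed sent: for every ML decoder the frame error
rate is at most the probability that some nonzero message has a codeword at least as likely as zero
(`BIOSChannel.FER_le_confusion`), a bound that does not see tie-breaking.

Sort nonzero messages by their last nonzero index l. Over the ensemble such a codeword is uniform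
left of stair l, all ones on it and zero beyond. With r = P(y|1)/P(y|0) and t = (1 + r)/2, its mean
likelihood ratio to zero is therefore a product of factors t, r and 1. Gallager's bound min(1, x) ≤
x^ρ then gives the union bound ∑ 2^(ρl) E[t^ρ]^(s_l) E[r^ρ]^(w_l), where s_l is the start of stair l
(`BIOSChannel.sum_wordLaw_confusion_le`).

Since C = -E[log₂ t], for each c < C some ρ in (0, 1] has E[t^ρ] ≤ 2^(-ρc); by concavity E[r^ρ] ≤ 2
E[t^ρ] - 1, which is below 1 when c > 0. Let the first stair have width n - k + 1 and the others
width 1. The term l = 0 decays exponentially in n - k, and each other term is at most 2^(ρ(k - cn)),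
so the total vanishes at rates C - δ. -/

open Filter Topology

/-- The Lebesgue integral of a product of functions of separate coordinates. -/
theorem lintegral_pi_prod {ι : Type*} [Fintype ι] {Y : Type*} [MeasurableSpace Y]
    (ν : ι → Measure Y) [∀ i, IsProbabilityMeasure (ν i)] {f : ι → Y → ℝ≥0∞}
    (hf : ∀ i, Measurable (f i)) :
    ∫⁻ y, ∏ i, f i (y i) ∂(Measure.pi ν) = ∏ i, ∫⁻ y, f i y ∂(ν i) := by
  have h := ProbabilityTheory.iIndepFun_pi (μ := ν) (X := f) fun i => (hf i).aemeasurable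
  rw [ProbabilityTheory.lintegral_prod_eq_prod_lintegral_of_indepFun Finset.univ
    (fun i (y : ι → Y) => f i (y i)) h fun i => (hf i).comp (measurable_pi_apply i)]
  refine Finset.prod_congr rfl fun i _ => ?_
  exact (measurePreserving_eval ν i).lintegral_comp (hf i)

/-! ### Channel symmetry and reduction to the zero codeword. -/

namespace BIOSChannel

variable {Y : Type*} [MeasurableSpace Y] (W : BIOSChannel Y)

instance isProbabilityMeasure_law (x : ZMod 2) : IsProbabilityMeasure (W.law x) :=
  ⟨by simp [law, W.lintegral_p x]⟩

theorem measurable_coe_p (x : ZMod 2) : Measurable fun y => (W.p x y : ℝ≥0∞) :=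
  (W.measurable_p x).coe_nnreal_ennreal

/-- The output permutation that turns the input `x` into the input `0`. -/
noncomputable def flip (x : ZMod 2) : Y → Y := if x = 0 then id else W.π

theorem p_add (x d : ZMod 2) (y : Y) : W.p (x + d) y = W.p d (W.flip x y) := by
  have h : ∀ z, W.p 0 z = W.p 1 (W.π z) := fun z => by rw [W.symm, W.involutive_π]
  have h2 : ∀ z : ZMod 2, z = 0 ∨ z = 1 := by decide
  rcases h2 x with rfl | rfl
  · simp [flip]
  · rcases h2 d with rfl | rfl
    · simpa [flip] using W.symm y
    · simpa [flip, show (1 : ZMod 2) + 1 = 0 from rfl] using h y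

theorem measurePreserving_flip_μ (x : ZMod 2) : MeasurePreserving (W.flip x) W.μ W.μ := by
  unfold flip
  split_ifs
  · exact MeasurePreserving.id _
  · exact W.measurePreserving_π

theorem measurePreserving_flip (x : ZMod 2) :
    MeasurePreserving (W.flip x) (W.law x) (W.law 0) := by
  refine ⟨(W.measurePreserving_flip_μ x).measurable, ?_⟩
  ext s hs
  rw [Measure.map_apply (W.measurePreserving_flip_μ x).measurable hs, law, law,
    withDensity_apply _ hs,
    withDensity_apply _ ((W.measurePreserving_flip_μ x).measurable hs),
    ← (W.measurePreserving_flip_μ x).setLIntegral_comp_preimage hs (W.measurable_coe_p 0)]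
  congr 1
  ext y
  rw [← W.p_add x 0, add_zero]

theorem measurePreserving_flip_word {n : ℕ} (c : Fin n → ZMod 2) :
    MeasurePreserving (fun (y : Fin n → Y) i => W.flip (c i) (y i))
      (W.wordLaw c) (W.wordLaw 0) :=
  measurePreserving_pi _ _ fun i => W.measurePreserving_flip (c i)

theorem likelihood_add {n : ℕ} (c d : Fin n → ZMod 2) (y : Fin n → Y) :
    W.likelihood (c + d) y = W.likelihood d fun i => W.flip (c i) (y i) :=
  Finset.prod_congr rfl fun i _ => W.p_add (c i) (d i) (y i)

theorem measurable_likelihood {n : ℕ} (c : Fin n → ZMod 2) : Measurable (W.likelihood c) :=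
  Finset.measurable_fun_prod _ fun i _ => (W.measurable_p (c i)).comp (measurable_pi_apply i)

/-- The event that the zero codeword is not strictly more likely than all the others. -/
def confusion {k n : ℕ} (G : Matrix (Fin k) (Fin n) (ZMod 2)) : Set (Fin n → Y) :=
  {y | ∃ v : Fin k → ZMod 2, v ≠ 0 ∧ W.likelihood 0 y ≤ W.likelihood (Matrix.vecMul v G) y}

theorem measurableSet_confusion {k n : ℕ} (G : Matrix (Fin k) (Fin n) (ZMod 2)) :
    MeasurableSet (W.confusion G) := by
  have : W.confusion G = ⋃ v : Fin k → ZMod 2, ⋃ _ : v ≠ 0,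
      {y | W.likelihood 0 y ≤ W.likelihood (Matrix.vecMul v G) y} := by
    ext y; simp [confusion]
  rw [this]
  exact MeasurableSet.iUnion fun v => MeasurableSet.iUnion fun _ =>
    measurableSet_le (W.measurable_likelihood _) (W.measurable_likelihood _)

instance isProbabilityMeasure_wordLaw {n : ℕ} (c : Fin n → ZMod 2) :
    IsProbabilityMeasure (W.wordLaw c) := by
  unfold wordLaw; infer_instance

/-- Flipping the outputs along the sent codeword carries its output law to that of zero and, by
linearity, every error to a confusion with zero. -/
theorem FER_le_confusion {k n : ℕ} {G : Matrix (Fin k) (Fin n) (ZMod 2)}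
    {dec : (Fin n → Y) → (Fin k → ZMod 2)} (hdec : W.IsMLDecoder G dec) :
    W.FER G dec ≤ (W.wordLaw 0).real (W.confusion G) := by
  have key : ∀ u : Fin k → ZMod 2,
      (W.wordLaw (Matrix.vecMul u G)).real {y | dec y ≠ u} ≤
        (W.wordLaw 0).real (W.confusion G) := by
    intro u
    rw [← (W.measurePreserving_flip_word (Matrix.vecMul u G)).measureReal_preimage
      (W.measurableSet_confusion G).nullMeasurableSet]
    refine measureReal_mono ?_
    intro y hy
    -- The competitor of zero is the difference between decoded and sent messages.
    refine ⟨dec y - u, sub_ne_zero.2 hy, ?_⟩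
    rw [← W.likelihood_add, ← W.likelihood_add, add_zero, ← Matrix.add_vecMul,
      add_sub_cancel]
    exact hdec y u
  unfold FER
  rw [div_le_iff₀ (by positivity)]
  refine (Finset.sum_le_sum fun u _ => key u).trans_eq ?_
  simp [mul_comm]

/-! ### The likelihood ratio and the capacity. -/

/-- The likelihood ratio `P(y|1) / P(y|0)`. -/
noncomputable def ratio (y : Y) : ℝ≥0 := W.p 1 y / W.p 0 y

theorem measurable_ratio : Measurable W.ratio := (W.measurable_p 1).div (W.measurable_p 0)

theorem ae_law_ne_zero : ∀ᵐ y ∂W.law 0, W.p 0 y ≠ 0 := by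
  rw [law, ae_withDensity_iff (W.measurable_coe_p 0)]
  exact Eventually.of_forall fun y hy => by simpa using hy

/-- Only an inequality: where P(y|0) = 0 the mass of P(y|1) is lost. -/
theorem lintegral_ratio_le_one : ∫⁻ y, (W.ratio y : ℝ≥0∞) ∂W.law 0 ≤ 1 := by
  rw [law, lintegral_withDensity_eq_lintegral_mul _ (W.measurable_coe_p 0)
    W.measurable_ratio.coe_nnreal_ennreal, ← W.lintegral_p 1]
  refine lintegral_mono fun y => ?_
  rw [Pi.mul_apply, ← ENNReal.coe_mul, ENNReal.coe_le_coe, ratio]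
  by_cases h : W.p 0 y = 0
  · simp [h]
  · rw [mul_div_cancel₀ _ h]

theorem integrable_ratio : Integrable (fun y => (W.ratio y : ℝ)) (W.law 0) := by
  refine ⟨W.measurable_ratio.coe_nnreal_real.aestronglyMeasurable, ?_⟩
  rw [HasFiniteIntegral]
  simp only [Real.enorm_eq_ofReal NNReal.zero_le_coe, ENNReal.ofReal_coe_nnreal]
  exact W.lintegral_ratio_le_one.trans_lt ENNReal.one_lt_top

/-- The substitution y ↦ π y swaps the two densities and fixes their equal mixture. -/
theorem partialMutualInfo_half_symm :
    W.partialMutualInfo 1 (1 / 2) = W.partialMutualInfo 0 (1 / 2) := by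
  let e : Y ≃ᵐ Y :=
    { toEquiv := W.involutive_π.toPerm
      measurable_toFun := W.measurePreserving_π.measurable
      measurable_invFun := W.measurePreserving_π.measurable }
  have he : MeasurePreserving e W.μ W.μ := W.measurePreserving_π
  have h : ∀ z, W.p 0 z = W.p 1 (W.π z) := fun z => by rw [W.symm, W.involutive_π]
  unfold partialMutualInfo
  rw [← he.integral_comp' (g := fun y => (W.p 0 y : ℝ) * Real.logb 2
    ((W.p 0 y : ℝ) / W.outputDensity (1 / 2) y))]
  congr 1
  ext y
  change _ = (W.p 0 (W.π y) : ℝ) * Real.logb 2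
    ((W.p 0 (W.π y) : ℝ) / W.outputDensity (1 / 2) (W.π y))
  simp only [outputDensity]
  rw [← h, ← W.symm]
  ring_nf

/-- The capacity as the mean of `-log₂ ((1 + P(y|1)/P(y|0)) / 2)` when `0` is sent. -/
theorem capacity_eq_integral_log_ratio :
    W.capacity * Real.log 2 = -∫ y, Real.log ((1 + W.ratio y) / 2) ∂W.law 0 := by
  have h0 : W.partialMutualInfo 0 (1 / 2) =
      ∫ y, Real.logb 2 ((W.p 0 y : ℝ) / W.outputDensity (1 / 2) y) ∂W.law 0 := by
    rw [law, integral_withDensity_eq_integral_smul (W.measurable_p 0)]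
    rfl
  rw [capacity, mutualInfo, W.partialMutualInfo_half_symm, h0, ← integral_neg,
    show ∀ a : ℝ, (1 - 1 / 2) * a + 1 / 2 * a = a from fun a => by ring, ← integral_mul_const]
  refine integral_congr_ae ?_
  filter_upwards [W.ae_law_ne_zero] with y hy
  have hy' : (W.p 0 y : ℝ) ≠ 0 := by exact_mod_cast hy
  rw [Real.logb, div_mul_cancel₀ _ (Real.log_pos one_lt_two).ne', ← Real.log_inv]
  congr 1
  rw [ratio, outputDensity, NNReal.coe_div]
  have h1 : 0 < (W.p 0 y : ℝ) := lt_of_le_of_ne (NNReal.coe_nonneg _) hy'.symm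
  have h2 : 0 ≤ (W.p 1 y : ℝ) := NNReal.coe_nonneg _
  field_simp
  ring_nf

end BIOSChannel

/-! ### Tilted moments of the likelihood ratio. -/

namespace BIOSChannel

variable {Y : Type*} [MeasurableSpace Y] (W : BIOSChannel Y)

/-- The normalized output density `(1 + P(y|1)/P(y|0)) / 2` relative to the input `0`. -/
noncomputable def mixRatio (y : Y) : ℝ≥0 := (1 + W.ratio y) / 2

theorem measurable_mixRatio : Measurable W.mixRatio :=
  (measurable_const.add W.measurable_ratio).div_const 2

theorem coe_mixRatio (y : Y) : (W.mixRatio y : ℝ) = (1 + W.ratio y) / 2 := by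
  simp [mixRatio]

theorem half_le_mixRatio (y : Y) : (1 / 2 : ℝ) ≤ W.mixRatio y := by
  rw [coe_mixRatio]
  have : (0 : ℝ) ≤ W.ratio y := NNReal.coe_nonneg _
  linarith

theorem mixRatio_pos (y : Y) : (0 : ℝ) < W.mixRatio y :=
  one_half_pos.trans_le (W.half_le_mixRatio y)

theorem integrable_mixRatio : Integrable (fun y => (W.mixRatio y : ℝ)) (W.law 0) := by
  simp only [coe_mixRatio]
  exact ((integrable_const 1).add W.integrable_ratio).div_const 2

theorem neg_log_two_le_log_mixRatio (y : Y) : -Real.log 2 ≤ Real.log (W.mixRatio y) := by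
  rw [← Real.log_inv]
  exact Real.log_le_log (by norm_num) (by simpa using W.half_le_mixRatio y)

theorem integrable_log_mixRatio :
    Integrable (fun y => Real.log (W.mixRatio y)) (W.law 0) := by
  refine (W.integrable_mixRatio.add (integrable_const 1)).mono'
    (W.measurable_mixRatio.coe_nnreal_real.log).aestronglyMeasurable
    (Eventually.of_forall fun y => ?_)
  have h1 := W.neg_log_two_le_log_mixRatio y
  have h2 := Real.log_le_sub_one_of_pos (W.mixRatio_pos y)
  have h3 := W.mixRatio_pos y
  have h4 := Real.log_two_lt_d9
  simp only [Pi.add_apply]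
  rw [Real.norm_eq_abs, abs_le]
  constructor <;> linarith

theorem capacity_mul_log_two :
    W.capacity * Real.log 2 = -∫ y, Real.log (W.mixRatio y) ∂W.law 0 := by
  simp only [coe_mixRatio]
  exact W.capacity_eq_integral_log_ratio

theorem capacity_le_one : W.capacity ≤ 1 := by
  have h2 : 0 < Real.log 2 := Real.log_pos one_lt_two
  refine le_of_mul_le_mul_right ?_ h2
  rw [W.capacity_mul_log_two, one_mul, neg_le]
  have := integral_mono (integrable_const (μ := W.law 0) (-Real.log 2))
    W.integrable_log_mixRatio W.neg_log_two_le_log_mixRatio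
  simpa using this

/-- The lower bound is 1 + x ≤ eˣ, the upper one Bernoulli's inequality for exponents at most 1. -/
theorem mixRatio_rpow_bounds (y : Y) {ρ : ℝ} (h0 : 0 < ρ) (h1 : ρ ≤ 1) :
    1 + ρ * Real.log (W.mixRatio y) ≤ (W.mixRatio y : ℝ) ^ ρ ∧
      (W.mixRatio y : ℝ) ^ ρ ≤ 1 + ρ * (W.mixRatio y - 1) := by
  have ht := W.mixRatio_pos y
  constructor
  · rw [Real.rpow_def_of_pos ht]
    have := Real.add_one_le_exp (Real.log (W.mixRatio y) * ρ)
    linarith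
  · have := rpow_one_add_le_one_add_mul_self (s := (W.mixRatio y : ℝ) - 1) (by linarith)
      h0.le h1
    simpa using this

theorem integrable_mixRatio_rpow {ρ : ℝ} (h0 : 0 < ρ) (h1 : ρ ≤ 1) :
    Integrable (fun y => (W.mixRatio y : ℝ) ^ ρ) (W.law 0) := by
  refine ((integrable_const 1).add
    ((W.integrable_mixRatio.sub (integrable_const 1)).const_mul ρ)).mono'
    (W.measurable_mixRatio.coe_nnreal_real.pow_const ρ).aestronglyMeasurable
    (Eventually.of_forall fun y => ?_)
  rw [Real.norm_of_nonneg (Real.rpow_nonneg (NNReal.coe_nonneg _) _)]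
  simpa using (W.mixRatio_rpow_bounds y h0 h1).2

/-- The derivative of E[t^ρ] at ρ = 0 is E[log t], by dominated convergence. -/
theorem tendsto_integral_mixRatio_rpow :
    Tendsto (fun ρ : ℝ => ∫ y, ρ⁻¹ * ((W.mixRatio y : ℝ) ^ ρ - 1) ∂W.law 0) (𝓝[>] 0)
      (𝓝 (∫ y, Real.log (W.mixRatio y) ∂W.law 0)) := by
  refine tendsto_integral_filter_of_dominated_convergence (fun y => (W.mixRatio y : ℝ) + 1)
    ?_ ?_ (W.integrable_mixRatio.add (integrable_const 1)) ?_
  · refine Eventually.of_forall fun ρ => Measurable.aestronglyMeasurable ?_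
    exact ((W.measurable_mixRatio.coe_nnreal_real.pow_const ρ).sub_const 1).const_mul _
  · filter_upwards [Ioc_mem_nhdsGT (zero_lt_one' ℝ)] with ρ hρ
    refine Eventually.of_forall fun y => ?_
    obtain ⟨hl, hu⟩ := W.mixRatio_rpow_bounds y hρ.1 hρ.2
    have h1 := W.neg_log_two_le_log_mixRatio y
    have h3 := W.mixRatio_pos y
    have h4 := Real.log_two_lt_d9
    -- The difference quotient lies between log t ≥ -log 2 and t - 1.
    rw [Real.norm_eq_abs, abs_le, inv_mul_eq_div, le_div_iff₀ hρ.1, div_le_iff₀ hρ.1]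
    have hρ0 := hρ.1
    constructor <;> nlinarith
  · refine Eventually.of_forall fun y => ?_
    have h := ((Real.hasStrictDerivAt_const_rpow (W.mixRatio_pos y) 0).hasDerivAt
      ).tendsto_slope_zero_right
    simpa using h

/-- Below capacity, some tilted moment of the normalized output density decays at that rate. -/
theorem exists_lintegral_mixRatio_rpow_le {c : ℝ} (hc : c < W.capacity) :
    ∃ ρ : ℝ, 0 < ρ ∧ ρ ≤ 1 ∧
      ∫⁻ y, ((W.mixRatio y ^ ρ : ℝ≥0) : ℝ≥0∞) ∂W.law 0 ≤ ENNReal.ofReal (2 ^ (-(ρ * c))) := by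
  have h2 : 0 < Real.log 2 := Real.log_pos one_lt_two
  have hlt : ∫ y, Real.log (W.mixRatio y) ∂W.law 0 < -(c * Real.log 2) := by
    have := W.capacity_mul_log_two
    have := mul_lt_mul_of_pos_right hc h2
    linarith
  obtain ⟨ρ, hρ, h0, h1⟩ := ((W.tendsto_integral_mixRatio_rpow.eventually_lt_const hlt).and
    (Ioc_mem_nhdsGT (zero_lt_one' ℝ))).exists
  refine ⟨ρ, h0, h1, ?_⟩
  have hint := W.integrable_mixRatio_rpow h0 h1
  have heq : ∫⁻ y, ((W.mixRatio y ^ ρ : ℝ≥0) : ℝ≥0∞) ∂W.law 0 =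
      ENNReal.ofReal (∫ y, (W.mixRatio y : ℝ) ^ ρ ∂W.law 0) := by
    rw [ofReal_integral_eq_lintegral_ofReal hint
      (Eventually.of_forall fun y => Real.rpow_nonneg (NNReal.coe_nonneg _) _)]
    simp [← NNReal.coe_rpow]
  rw [heq]
  refine ENNReal.ofReal_le_ofReal ?_
  rw [integral_const_mul, integral_sub hint (integrable_const 1), inv_mul_eq_div,
    div_lt_iff₀ h0] at hρ
  simp only [integral_const, probReal_univ, smul_eq_mul, mul_one] at hρ
  rw [Real.rpow_def_of_pos two_pos]
  -- The choice of ρ gives E[t^ρ] < 1 - ρ c log 2, which is at most 2^(-ρc).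
  have := Real.add_one_le_exp (Real.log 2 * -(ρ * c))
  nlinarith

/-- Midpoint concavity of x ↦ x^ρ at 1 and r, integrated. It controls the columns on the stair. -/
theorem lintegral_ratio_rpow_add_one_le {ρ : ℝ} (h0 : 0 ≤ ρ) (h1 : ρ ≤ 1) :
    ∫⁻ y, ((W.ratio y ^ ρ : ℝ≥0) : ℝ≥0∞) ∂W.law 0 + 1 ≤
      2 * ∫⁻ y, ((W.mixRatio y ^ ρ : ℝ≥0) : ℝ≥0∞) ∂W.law 0 := by
  have hone : (1 : ℝ≥0∞) = ∫⁻ _, 1 ∂W.law 0 := by simp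
  rw [hone, ← lintegral_add_right _ measurable_const, ← lintegral_const_mul _
    (W.measurable_mixRatio.pow_const ρ).coe_nnreal_ennreal]
  refine lintegral_mono fun y => ?_
  have h := (NNReal.concaveOn_rpow h0 h1).2 (Set.mem_univ (1 : ℝ≥0))
    (Set.mem_univ (W.ratio y)) (zero_le (a := 1 / 2)) (zero_le (a := 1 / 2))
    (add_halves 1)
  have h' : W.ratio y ^ ρ + 1 ≤ 2 * W.mixRatio y ^ ρ := by
    rw [mixRatio]
    simp only [smul_eq_mul, NNReal.one_rpow, mul_one] at h
    rw [show (1 + W.ratio y) / 2 = 1 / 2 + 1 / 2 * W.ratio y by ring]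
    calc W.ratio y ^ ρ + 1 = 2 * (1 / 2 + 1 / 2 * W.ratio y ^ ρ) := by
          rw [mul_add, ← mul_assoc]; simp [add_comm]
      _ ≤ _ := by gcongr
  simpa only [ENNReal.coe_add, ENNReal.coe_mul, ENNReal.coe_one, ENNReal.coe_ofNat] using
    ENNReal.coe_le_coe.2 h'

end BIOSChannel

/-! ### Messages sorted by their last nonzero entry. -/

theorem Fin.prod_univ_ite_lt {M : Type*} [CommMonoid M] {n s w : ℕ} (h : s + w ≤ n) (a b : M) :
    ∏ i : Fin n, (if (i : ℕ) < s then a else if (i : ℕ) < s + w then b else 1) =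
      a ^ s * b ^ w := by
  obtain ⟨m, rfl⟩ := Nat.exists_eq_add_of_le h
  rw [Fin.prod_univ_eq_prod_range
    (fun i => if i < s then a else if i < s + w then b else 1) (s + w + m),
    Finset.prod_range_add, Finset.prod_range_add]
  have h1 : ∏ x ∈ Finset.range s, (if x < s then a else if x < s + w then b else 1) = a ^ s := by
    rw [Finset.prod_congr rfl fun x hx => if_pos (Finset.mem_range.1 hx)]
    simp
  have h2 : ∏ x ∈ Finset.range w,
      (if s + x < s then a else if s + x < s + w then b else 1) = b ^ w := by
    rw [Finset.prod_congr rfl fun x hx => by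
      rw [if_neg (by omega), if_pos (by simpa using Finset.mem_range.1 hx)]]
    simp
  rw [h1, h2]
  simp [show ∀ x, ¬ s + w + x < s by intro x; omega]

/-- The messages whose last nonzero entry is the `l`-th. -/
def messagesWithLast {k : ℕ} (l : Fin k) : Finset (Fin k → ZMod 2) :=
  Fintype.piFinset fun j => if j < l then Finset.univ else if j = l then {1} else {0}

theorem apply_eq_one_of_mem_messagesWithLast {k : ℕ} {l : Fin k} {v : Fin k → ZMod 2}
    (hv : v ∈ messagesWithLast l) : v l = 1 := by
  simpa using Fintype.mem_piFinset.1 hv l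

theorem apply_eq_zero_of_mem_messagesWithLast {k : ℕ} {l j : Fin k} {v : Fin k → ZMod 2}
    (hv : v ∈ messagesWithLast l) (hj : l < j) : v j = 0 := by
  simpa [hj.not_gt, hj.ne'] using Fintype.mem_piFinset.1 hv j

theorem card_messagesWithLast {k : ℕ} (l : Fin k) : (messagesWithLast l).card = 2 ^ (l : ℕ) := by
  rw [messagesWithLast, Fintype.card_piFinset]
  have := Fin.prod_univ_ite_lt (s := (l : ℕ)) (w := 0) (n := k) l.2.le 2 1
  rw [pow_zero, mul_one] at this
  rw [← this]
  refine Finset.prod_congr rfl fun j _ => ?_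
  simp only [← Fin.lt_def]
  split_ifs <;> simp

theorem exists_mem_messagesWithLast {k : ℕ} {v : Fin k → ZMod 2} (hv : v ≠ 0) :
    ∃ l, v ∈ messagesWithLast l := by
  have h2 : ∀ z : ZMod 2, z ≠ 0 → z = 1 := by decide
  have hne : (Finset.univ.filter fun j => v j ≠ 0).Nonempty := by
    obtain ⟨j, hj⟩ := Function.ne_iff.1 hv
    exact ⟨j, by simpa using hj⟩
  refine ⟨Finset.max' _ hne, Fintype.mem_piFinset.2 fun j => ?_⟩
  have hmem := Finset.max'_mem _ hne
  have hmax : ∀ j, v j ≠ 0 → j ≤ Finset.max' _ hne := fun j hj =>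
    Finset.le_max' _ j (by simpa using hj)
  split_ifs with h1 h3
  · exact Finset.mem_univ _
  · rw [h3]
    simpa using h2 _ (Finset.mem_filter.1 hmem).2
  · rw [Finset.mem_singleton]
    by_contra h
    exact h3 (le_antisymm (hmax j h) (not_lt.1 h1))

/-! ### Codewords of the staircase ensemble. -/

section Staircase

variable {k n : ℕ} {w : Fin k → ℕ}

theorem stairStart_add_le_stairStart (w : Fin k → ℕ) {j l : Fin k} (h : j < l) :
    stairStart w j + w j ≤ stairStart w l := by
  classical
  unfold stairStart
  rw [add_comm, ← Finset.sum_insert (by simp)]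
  refine Finset.sum_le_sum_of_subset fun i hi => ?_
  rcases Finset.mem_insert.1 hi with rfl | hi
  · simpa using h
  · simpa using (Finset.mem_filter.1 hi).2.trans h

theorem stairStart_add_le_sum (w : Fin k → ℕ) (l : Fin k) :
    stairStart w l + w l ≤ ∑ i, w i := by
  classical
  unfold stairStart
  rw [add_comm, ← Finset.sum_insert (by simp)]
  exact Finset.sum_le_sum_of_subset (Finset.subset_univ _)

theorem mem_staircaseEnsemble {G : Matrix (Fin k) (Fin n) (ZMod 2)} :
    G ∈ staircaseEnsemble n w ↔ IsStaircase w G := by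
  simp [staircaseEnsemble]

theorem staircaseEnsemble_nonempty (n : ℕ) (w : Fin k → ℕ) :
    (staircaseEnsemble n w).Nonempty := by
  refine ⟨Matrix.of fun l j => if (j : ℕ) < stairStart w l + w l then 1 else 0,
    mem_staircaseEnsemble.2 fun l j => ⟨fun _ h => ?_, fun h => ?_⟩⟩
  · simp [h]
  · simp [h.not_gt]

/-- Earlier rows have already ended here and later rows have coefficient 0, so only row `l`
contributes. -/
theorem IsStaircase.vecMul_eq_one {G : Matrix (Fin k) (Fin n) (ZMod 2)} (hG : IsStaircase w G)
    {l : Fin k} {v : Fin k → ZMod 2} (hv : v ∈ messagesWithLast l) {i : Fin n}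
    (h1 : stairStart w l ≤ i) (h2 : (i : ℕ) < stairStart w l + w l) :
    Matrix.vecMul v G i = 1 := by
  rw [Matrix.vecMul, dotProduct, Finset.sum_eq_single l]
  · rw [apply_eq_one_of_mem_messagesWithLast hv, (hG l i).1 h1 h2, one_mul]
  · intro j _ hj
    rcases lt_or_gt_of_ne hj with h | h
    · rw [(hG j i).2 ((stairStart_add_le_stairStart w h).trans h1), mul_zero]
    · rw [apply_eq_zero_of_mem_messagesWithLast hv h, zero_mul]
  · simp

theorem IsStaircase.vecMul_eq_zero {G : Matrix (Fin k) (Fin n) (ZMod 2)} (hG : IsStaircase w G)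
    {l : Fin k} {v : Fin k → ZMod 2} (hv : v ∈ messagesWithLast l) {i : Fin n}
    (h : stairStart w l + w l ≤ i) : Matrix.vecMul v G i = 0 := by
  rw [Matrix.vecMul, dotProduct]
  refine Finset.sum_eq_zero fun j _ => ?_
  rcases lt_trichotomy j l with hj | rfl | hj
  · rw [(hG j i).2 ((stairStart_add_le_stairStart w hj).trans (le_self_add.trans h)), mul_zero]
  · rw [(hG j i).2 h, mul_zero]
  · rw [apply_eq_zero_of_mem_messagesWithLast hv hj, zero_mul]

/-- The words supported on the columns to the left of the `l`-th stair. -/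
def leftWords (n : ℕ) (w : Fin k → ℕ) (l : Fin k) : Finset (Fin n → ZMod 2) :=
  Fintype.piFinset fun i => if (i : ℕ) < stairStart w l then Finset.univ else {0}

theorem IsStaircase.add_vecMulVec {G : Matrix (Fin k) (Fin n) (ZMod 2)} (hG : IsStaircase w G)
    {l : Fin k} {h : Fin n → ZMod 2} (hh : h ∈ leftWords n w l) :
    IsStaircase w (G + Matrix.vecMulVec (Pi.single l 1) h) := by
  have h0 : ∀ i : Fin n, stairStart w l ≤ i → h i = 0 := fun i hi => by
    simpa [hi.not_gt] using Fintype.mem_piFinset.1 hh i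
  intro j i
  rw [Matrix.add_apply, Matrix.vecMulVec_apply]
  rcases eq_or_ne j l with rfl | hj
  · refine ⟨fun h1 h2 => ?_, fun h1 => ?_⟩
    · rw [h0 i h1, mul_zero, add_zero, (hG j i).1 h1 h2]
    · rw [h0 i (le_self_add.trans h1), mul_zero, add_zero, (hG j i).2 h1]
  · rw [Pi.single_eq_of_ne hj, zero_mul, add_zero]
    exact hG j i

/-- A random codeword whose message ends at `l` is uniform to the left of the `l`-th stair. -/
theorem sum_staircaseEnsemble_mul_card {R : Type*} [CommSemiring R] (F : (Fin n → ZMod 2) → R)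
    {l : Fin k} {v : Fin k → ZMod 2} (hv : v ∈ messagesWithLast l) :
    (∑ G ∈ staircaseEnsemble n w, F (Matrix.vecMul v G)) * (leftWords n w l).card =
      ∑ G ∈ staircaseEnsemble n w, ∑ h ∈ leftWords n w l, F (Matrix.vecMul v G + h) := by
  rw [Finset.sum_comm, mul_comm, ← nsmul_eq_mul, ← Finset.sum_const]
  refine Finset.sum_congr rfl fun h hh => ?_
  have hmap : ∀ G ∈ staircaseEnsemble n w,
      G + Matrix.vecMulVec (Pi.single l 1) h ∈ staircaseEnsemble n w := fun G hG =>
    mem_staircaseEnsemble.2 ((mem_staircaseEnsemble.1 hG).add_vecMulVec hh)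
  have hinv : ∀ G ∈ staircaseEnsemble n w,
      G + Matrix.vecMulVec (Pi.single l 1) h + Matrix.vecMulVec (Pi.single l 1) h = G := by
    intro G _
    ext j i
    rw [Matrix.add_apply, Matrix.add_apply, add_assoc, CharTwo.add_self_eq_zero, add_zero]
  -- Adding `h` to row `l` is an involution of the ensemble; since `v l = 1`, it shifts the codeword
  -- by `h`.
  refine Finset.sum_nbij' (fun G => G + Matrix.vecMulVec (Pi.single l 1) h)
    (fun G => G + Matrix.vecMulVec (Pi.single l 1) h) hmap hmap hinv hinv fun G _ => ?_
  rw [Matrix.vecMul_add, Matrix.vecMul_vecMulVec, dotProduct_single,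
    apply_eq_one_of_mem_messagesWithLast hv, mul_one, one_smul, add_assoc]
  congr 1
  ext i
  rw [Pi.add_apply, Pi.add_apply, CharTwo.add_self_eq_zero, add_zero]

end Staircase

/-! ### Gallager's bound averaged over the ensemble. -/

namespace BIOSChannel

variable {Y : Type*} [MeasurableSpace Y] (W : BIOSChannel Y) {k n : ℕ} {w : Fin k → ℕ}

/-- The likelihood ratio `P(y|x) / P(y|0)`. -/
noncomputable def symbolRatio (x : ZMod 2) (y : Y) : ℝ≥0 := if x = 0 then 1 else W.ratio y

theorem likelihood_eq_mul_prod_symbolRatio (c : Fin n → ZMod 2) {y : Fin n → Y}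
    (hy : ∀ i, W.p 0 (y i) ≠ 0) :
    W.likelihood c y = W.likelihood 0 y * ∏ i, W.symbolRatio (c i) (y i) := by
  have h2 : ∀ z : ZMod 2, z = 0 ∨ z = 1 := by decide
  rw [likelihood, likelihood, ← Finset.prod_mul_distrib]
  refine Finset.prod_congr rfl fun i _ => ?_
  rcases h2 (c i) with h | h
  · simp [symbolRatio, h]
  · simp [symbolRatio, h, ratio, mul_div_cancel₀ _ (hy i)]

/-- The mean likelihood ratio at column `i` of a random codeword whose message ends at `l`. -/
noncomputable def columnRatio (w : Fin k → ℕ) (l : Fin k) (i : ℕ) : Y → ℝ≥0 :=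
  if i < stairStart w l then W.mixRatio
  else if i < stairStart w l + w l then W.ratio else fun _ => 1

theorem measurable_columnRatio (w : Fin k → ℕ) (l : Fin k) (i : ℕ) :
    Measurable (W.columnRatio w l i) := by
  unfold columnRatio
  split_ifs
  · exact W.measurable_mixRatio
  · exact W.measurable_ratio
  · exact measurable_const

theorem sum_staircaseEnsemble_prod_symbolRatio {l : Fin k} {v : Fin k → ZMod 2}
    (hv : v ∈ messagesWithLast l) (y : Fin n → Y) :
    ∑ G ∈ staircaseEnsemble n w, ∏ i, W.symbolRatio (Matrix.vecMul v G i) (y i) =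
      (staircaseEnsemble n w).card * ∏ i : Fin n, W.columnRatio w l i (y i) := by
  have hcard : ((leftWords n w l).card : ℝ≥0) =
      ∏ i : Fin n, if (i : ℕ) < stairStart w l then 2 else 1 := by
    rw [leftWords, Fintype.card_piFinset, Nat.cast_prod]
    refine Finset.prod_congr rfl fun i _ => ?_
    split_ifs <;> simp
  have hne : ((leftWords n w l).card : ℝ≥0) ≠ 0 := by
    rw [hcard]
    refine Finset.prod_ne_zero_iff.2 fun i _ => ?_
    split_ifs <;> simp
  refine mul_right_cancel₀ hne ?_
  rw [sum_staircaseEnsemble_mul_card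
    (fun c => ∏ i, W.symbolRatio (c i) (y i)) hv, mul_assoc, ← nsmul_eq_mul, ← Finset.sum_const]
  refine Finset.sum_congr rfl fun G hG => ?_
  rw [mem_staircaseEnsemble] at hG
  rw [hcard, ← Finset.prod_mul_distrib, leftWords]
  simp only [Pi.add_apply]
  -- The shifts `h` range over a product set, so the sum factors column by column.
  rw [← Finset.prod_univ_sum _ fun i x => W.symbolRatio (Matrix.vecMul v G i + x) (y i)]
  refine Finset.prod_congr rfl fun i _ => ?_
  unfold columnRatio
  split_ifs with h1 h2
  · have h2 : ∀ z : ZMod 2, z = 0 ∨ z = 1 := by decide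
    have huniv : (Finset.univ : Finset (ZMod 2)) = {0, 1} := rfl
    have hmix : W.mixRatio (y i) * 2 = 1 + W.ratio (y i) := by simp [mixRatio]
    rw [huniv, Finset.sum_pair (by decide), hmix]
    rcases h2 (Matrix.vecMul v G i) with h | h
    · simp [symbolRatio, h]
    · simp [symbolRatio, h, show (1 : ZMod 2) + 1 = 0 from rfl, add_comm]
  · simp [symbolRatio, hG.vecMul_eq_one hv (not_lt.1 h1) h2]
  · simp [symbolRatio, hG.vecMul_eq_zero hv (not_lt.1 h2)]

/-- The event that some codeword whose message ends at `l` is at least as likely as zero. -/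
def confusionAt (G : Matrix (Fin k) (Fin n) (ZMod 2)) (l : Fin k) : Set (Fin n → Y) :=
  {y | ∃ v ∈ messagesWithLast l, W.likelihood 0 y ≤ W.likelihood (Matrix.vecMul v G) y}

theorem measurableSet_confusionAt (G : Matrix (Fin k) (Fin n) (ZMod 2)) (l : Fin k) :
    MeasurableSet (W.confusionAt G l) := by
  have : W.confusionAt G l = ⋃ v ∈ messagesWithLast l,
      {y | W.likelihood 0 y ≤ W.likelihood (Matrix.vecMul v G) y} := by
    ext y; simp [confusionAt]
  rw [this]
  exact Finset.measurableSet_biUnion _ fun v _ =>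
    measurableSet_le (W.measurable_likelihood _) (W.measurable_likelihood _)

theorem confusion_subset (G : Matrix (Fin k) (Fin n) (ZMod 2)) :
    W.confusion G ⊆ ⋃ l, W.confusionAt G l := by
  rintro y ⟨v, hv, h⟩
  obtain ⟨l, hl⟩ := exists_mem_messagesWithLast hv
  exact Set.mem_iUnion.2 ⟨l, v, hl, h⟩

theorem ae_wordLaw_ne_zero : ∀ᵐ y ∂W.wordLaw (0 : Fin n → ZMod 2), ∀ i, W.p 0 (y i) ≠ 0 :=
  ae_all_iff.2 fun i => (measurePreserving_eval (fun _ : Fin n => W.law 0) i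
    ).quasiMeasurePreserving.ae W.ae_law_ne_zero

theorem sum_indicator_confusionAt_le (l : Fin k) {ρ : ℝ} (h0 : 0 ≤ ρ) (h1 : ρ ≤ 1)
    {y : Fin n → Y} (hy : ∀ i, W.p 0 (y i) ≠ 0) :
    ∑ G ∈ staircaseEnsemble n w, (W.confusionAt G l).indicator (1 : (Fin n → Y) → ℝ≥0) y ≤
      (staircaseEnsemble n w).card *
        (2 ^ (l : ℕ) * ∏ i : Fin n, W.columnRatio w l i (y i)) ^ ρ := by
  have hL : 0 < W.likelihood 0 y :=
    pos_iff_ne_zero.2 (Finset.prod_ne_zero_iff.2 fun i _ => hy i)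
  set a := 2 ^ (l : ℕ) * ∏ i : Fin n, W.columnRatio w l i (y i) with ha
  have hone : ∑ G ∈ staircaseEnsemble n w,
      (W.confusionAt G l).indicator (1 : (Fin n → Y) → ℝ≥0) y ≤
        (staircaseEnsemble n w).card * 1 := by
    rw [← nsmul_eq_mul, ← Finset.sum_const]
    exact Finset.sum_le_sum fun G _ => Set.indicator_apply_le' (fun _ => le_rfl) fun _ => zero_le_one
  have hmean : ∑ G ∈ staircaseEnsemble n w,
      (W.confusionAt G l).indicator (1 : (Fin n → Y) → ℝ≥0) y ≤
        (staircaseEnsemble n w).card * a := by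
    calc _ ≤ ∑ G ∈ staircaseEnsemble n w, ∑ v ∈ messagesWithLast l,
          ∏ i, W.symbolRatio (Matrix.vecMul v G i) (y i) := by
          refine Finset.sum_le_sum fun G _ => Set.indicator_apply_le' ?_ fun _ => zero_le
          rintro ⟨v, hv, h⟩
          rw [W.likelihood_eq_mul_prod_symbolRatio (Matrix.vecMul v G) hy] at h
          exact (le_of_mul_le_mul_left (by simpa using h) hL).trans
            (Finset.single_le_sum (f := fun v => ∏ i, W.symbolRatio (Matrix.vecMul v G i) (y i))
              (fun _ _ => zero_le) hv)
      _ = (staircaseEnsemble n w).card * a := by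
          rw [Finset.sum_comm, Finset.sum_congr rfl fun v hv =>
            W.sum_staircaseEnsemble_prod_symbolRatio hv y, Finset.sum_const,
            card_messagesWithLast, nsmul_eq_mul, ha]
          push_cast
          ring
  -- Gallager's step: min(1, a) ≤ a^ρ for 0 ≤ ρ ≤ 1.
  rcases le_total a 1 with h | h
  · refine hmean.trans (mul_le_mul_right ?_ _)
    rcases eq_or_ne a 0 with h' | h'
    · rw [h']; exact zero_le
    · simpa using NNReal.rpow_le_rpow_of_exponent_ge (pos_iff_ne_zero.2 h') h h1
  · exact hone.trans (mul_le_mul_right (NNReal.one_le_rpow h h0) _)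

/-- The outputs are independent, so each column contributes its own moment. -/
theorem lintegral_columnRatio_rpow (w : Fin k → ℕ) (hw : ∑ l, w l = n) (l : Fin k) (ρ : ℝ) :
    ∫⁻ y, (((2 ^ (l : ℕ) * ∏ i : Fin n, W.columnRatio w l i (y i)) ^ ρ : ℝ≥0) : ℝ≥0∞)
        ∂W.wordLaw (0 : Fin n → ZMod 2) =
      ((2 ^ (l : ℕ) : ℝ≥0) ^ ρ : ℝ≥0) *
        ((∫⁻ y, ((W.mixRatio y ^ ρ : ℝ≥0) : ℝ≥0∞) ∂W.law 0) ^ stairStart w l *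
          (∫⁻ y, ((W.ratio y ^ ρ : ℝ≥0) : ℝ≥0∞) ∂W.law 0) ^ w l) := by
  have hmeas : ∀ i : Fin n,
      Measurable fun y => ((W.columnRatio w l i y ^ ρ : ℝ≥0) : ℝ≥0∞) := fun i =>
    ((W.measurable_columnRatio w l i).pow_const ρ).coe_nnreal_ennreal
  simp only [NNReal.mul_rpow, ← NNReal.finsetProd_rpow, ENNReal.coe_mul, ENNReal.ofNNReal_finsetProd]
  rw [lintegral_const_mul' _ _ ENNReal.coe_ne_top, wordLaw]
  congr 1
  simp only [Pi.zero_apply]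
  rw [lintegral_pi_prod (fun _ : Fin n => W.law 0) hmeas,
    ← Fin.prod_univ_ite_lt ((stairStart_add_le_sum w l).trans hw.le)]
  refine Finset.prod_congr rfl fun i _ => ?_
  unfold columnRatio
  split_ifs <;> simp

/-- The union bound for the ensemble, with Gallager's exponent `ρ`. -/
theorem sum_wordLaw_confusion_le (w : Fin k → ℕ) (hw : ∑ l, w l = n) {ρ : ℝ} (h0 : 0 ≤ ρ)
    (h1 : ρ ≤ 1) :
    ∑ G ∈ staircaseEnsemble n w, W.wordLaw 0 (W.confusion G) ≤
      (staircaseEnsemble n w).card * ∑ l : Fin k, ((2 ^ (l : ℕ) : ℝ≥0) ^ ρ : ℝ≥0) *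
        ((∫⁻ y, ((W.mixRatio y ^ ρ : ℝ≥0) : ℝ≥0∞) ∂W.law 0) ^ stairStart w l *
          (∫⁻ y, ((W.ratio y ^ ρ : ℝ≥0) : ℝ≥0∞) ∂W.law 0) ^ w l) := by
  calc _ ≤ ∑ G ∈ staircaseEnsemble n w, ∑ l, W.wordLaw 0 (W.confusionAt G l) :=
        Finset.sum_le_sum fun G _ => (measure_mono (W.confusion_subset G)).trans
          (measure_iUnion_fintype_le _ _)
    _ = ∑ l, ∑ G ∈ staircaseEnsemble n w, W.wordLaw 0 (W.confusionAt G l) := Finset.sum_comm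
    _ ≤ _ := by
        rw [Finset.mul_sum]
        refine Finset.sum_le_sum fun l _ => ?_
        rw [← W.lintegral_columnRatio_rpow w hw l ρ, ← lintegral_const_mul']
        swap
        · exact ENNReal.natCast_ne_top _
        have hind : ∀ G : Matrix (Fin k) (Fin n) (ZMod 2), W.wordLaw 0 (W.confusionAt G l) =
            ∫⁻ y, (((W.confusionAt G l).indicator (1 : (Fin n → Y) → ℝ≥0) y : ℝ≥0) : ℝ≥0∞)
              ∂W.wordLaw 0 := fun G => by
          rw [← lintegral_indicator_one (W.measurableSet_confusionAt G l)]
          refine lintegral_congr fun y => ?_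
          by_cases h : y ∈ W.confusionAt G l <;> simp [h]
        simp only [hind]
        rw [← lintegral_finsetSum _ fun G _ => (measurable_one.indicator
          (W.measurableSet_confusionAt G l)).coe_nnreal_ennreal]
        refine lintegral_mono_ae ?_
        filter_upwards [W.ae_wordLaw_ne_zero] with y hy
        have := W.sum_indicator_confusionAt_le (w := w) l h0 h1 hy
        rw [← ENNReal.coe_le_coe] at this
        simpa only [ENNReal.ofNNReal_finsetSum, ENNReal.coe_mul, ENNReal.coe_natCast] using this

end BIOSChannel

/-! ### The profile with a wide first stair. -/

/-- The profile of length `n` whose stairs all have width one, except for the first. -/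
def wideFirstProfile (k n : ℕ) (l : Fin k) : ℕ := if (l : ℕ) = 0 then n - k + 1 else 1

theorem sum_wideFirstProfile {k n : ℕ} (hk : 0 < k) {s : Finset (Fin k)} (hs : ⟨0, hk⟩ ∈ s) :
    ∑ i ∈ s, wideFirstProfile k n i = n - k + s.card := by
  have h : ∀ i : Fin k, wideFirstProfile k n i = (if i = ⟨0, hk⟩ then n - k else 0) + 1 := by
    intro i
    simp only [wideFirstProfile, Fin.ext_iff]
    split_ifs <;> simp
  simp [h, Finset.sum_add_distrib, hs]

theorem isProfile_wideFirstProfile {k n : ℕ} (hk : 0 < k) (hkn : k ≤ n) :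
    IsProfile n (wideFirstProfile k n) := by
  refine ⟨fun l => ?_, ?_⟩
  · unfold wideFirstProfile
    split_ifs <;> omega
  · rw [sum_wideFirstProfile hk (Finset.mem_univ _), Finset.card_univ, Fintype.card_fin]
    omega

theorem stairStart_wideFirstProfile {k n : ℕ} {l : Fin k} (hl : (l : ℕ) ≠ 0) :
    stairStart (wideFirstProfile k n) l = n - k + l := by
  have hs : Finset.univ.filter (· < l) = Finset.Iio l := by ext; simp
  rw [stairStart, hs, sum_wideFirstProfile l.pos
    (Finset.mem_Iio.2 (Fin.lt_def.2 (Nat.pos_of_ne_zero hl))), Fin.card_Iio]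

theorem stairStart_of_val_eq_zero {k : ℕ} (w : Fin k → ℕ) {l : Fin k} (hl : (l : ℕ) = 0) :
    stairStart w l = 0 :=
  Finset.sum_eq_zero fun i hi => absurd (Fin.lt_def.1 (Finset.mem_filter.1 hi).2) (by omega)

theorem sum_union_bound_wideFirstProfile_le {k n : ℕ} (hk : 0 < k) (hkn : k ≤ n) {ρ c : ℝ}
    (hρ : 0 ≤ ρ) (hc1 : c ≤ 1) {g B : ℝ≥0∞}
    (hg : g ≤ ENNReal.ofReal (2 ^ (-(ρ * c)))) {b : ℝ} (hb0 : 0 ≤ b) (hb1 : b ≤ 1)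
    (hB : B ≤ ENNReal.ofReal b) :
    ∑ l : Fin k, (((2 ^ (l : ℕ) : ℝ≥0) ^ ρ : ℝ≥0) : ℝ≥0∞) *
        (g ^ stairStart (wideFirstProfile k n) l * B ^ wideFirstProfile k n l) ≤
      ENNReal.ofReal (b ^ (n - k + 1) + k * 2 ^ (ρ * (k - c * n))) := by
  have hterm : ∀ l : Fin k, (((2 ^ (l : ℕ) : ℝ≥0) ^ ρ : ℝ≥0) : ℝ≥0∞) *
      (g ^ stairStart (wideFirstProfile k n) l * B ^ wideFirstProfile k n l) ≤
        (if l = ⟨0, hk⟩ then ENNReal.ofReal (b ^ (n - k + 1)) else 0) +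
          ENNReal.ofReal (2 ^ (ρ * (k - c * n))) := by
    intro l
    by_cases hl : (l : ℕ) = 0
    · rw [if_pos (Fin.ext hl), stairStart_of_val_eq_zero _ hl, hl, wideFirstProfile, if_pos hl,
        ENNReal.ofReal_pow hb0]
      refine le_add_right ?_
      simpa using pow_le_pow_left' hB (n - k + 1)
    · rw [if_neg fun h => hl (by rw [h]), zero_add, stairStart_wideFirstProfile hl,
        wideFirstProfile, if_neg hl, pow_one]
      have hB1 : B ≤ 1 := hB.trans (by simpa using ENNReal.ofReal_le_ofReal hb1)
      have h2 : (((2 ^ (l : ℕ) : ℝ≥0) ^ ρ : ℝ≥0) : ℝ≥0∞) = ENNReal.ofReal (2 ^ (ρ * l)) := by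
        rw [← ENNReal.ofReal_coe_nnreal, NNReal.coe_rpow]
        push_cast
        rw [← Real.rpow_natCast_mul two_pos.le, mul_comm]
      calc _ ≤ ENNReal.ofReal (2 ^ (ρ * l)) *
            (ENNReal.ofReal (2 ^ (-(ρ * c))) ^ (n - k + l) * 1) := by
            rw [h2]
            gcongr
        _ = ENNReal.ofReal (2 ^ (ρ * l + -(ρ * c) * ((n - k + l : ℕ) : ℝ))) := by
            rw [mul_one, ← ENNReal.ofReal_pow (by positivity), ← Real.rpow_mul_natCast two_pos.le,
              ← ENNReal.ofReal_mul (by positivity), ← Real.rpow_add two_pos]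
        _ ≤ _ := by
            refine ENNReal.ofReal_le_ofReal (Real.rpow_le_rpow_of_exponent_le one_le_two ?_)
            have hlk : (l : ℝ) ≤ k := by exact_mod_cast l.2.le
            rw [Nat.cast_add, Nat.cast_sub hkn,
              -- As c ≤ 1, the exponent is nondecreasing in `l`; replacing `l` by `k` gives the
              -- uniform bound.
              show ρ * (l : ℝ) + -(ρ * c) * ((n : ℝ) - k + l) =
                ρ * (l * (1 - c) + c * k - c * n) by ring]
            refine mul_le_mul_of_nonneg_left ?_ hρ
            nlinarith [mul_le_mul_of_nonneg_right hlk (sub_nonneg.2 hc1)]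
  refine (Finset.sum_le_sum fun l _ => hterm l).trans_eq ?_
  rw [Finset.sum_add_distrib, Finset.sum_ite_eq', if_pos (Finset.mem_univ _), Finset.sum_const,
    Finset.card_univ, Fintype.card_fin, ENNReal.ofReal_add (by positivity) (by positivity),
    ENNReal.ofReal_mul (by positivity), nsmul_eq_mul, ENNReal.ofReal_natCast]

/-! ### Asymptotics below capacity. -/

namespace BIOSChannel

variable {Y : Type*} [MeasurableSpace Y] (W : BIOSChannel Y)

/-- Below capacity the mean probability of confusion with the zero codeword vanishes. -/
theorem exists_sum_confusion_wideFirstProfile_le {ε δ : ℝ} (hε : 0 < ε) (hδ : 0 < δ)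
    (hδC : δ < W.capacity) :
    ∃ N : ℕ, ∀ n : ℕ, N ≤ n → ∀ k : ℕ, 0 < k → k ≤ n →
      (k : ℝ) ≤ n * (W.capacity - δ) + 1 →
      ∑ G ∈ staircaseEnsemble n (wideFirstProfile k n), (W.wordLaw 0).real (W.confusion G) ≤
        (staircaseEnsemble n (wideFirstProfile k n)).card * ε := by
  set C := W.capacity
  have hC1 : C ≤ 1 := W.capacity_le_one
  obtain ⟨ρ, hρ0, hρ1, hg⟩ := W.exists_lintegral_mixRatio_rpow_le
    (show C - δ / 2 < W.capacity from sub_lt_self _ (half_pos hδ))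
  -- Half of the gap δ goes to the choice of ρ; the other half makes k - cn tend to -∞.
  set c := C - δ / 2
  have hc0 : 0 < c := by simp only [c]; linarith
  have hc1 : c ≤ 1 := by simp only [c]; linarith
  set a : ℝ := 2 ^ (-(ρ * c))
  have ha1 : a < 1 :=
    Real.rpow_lt_one_of_one_lt_of_neg one_lt_two (neg_neg_of_pos (mul_pos hρ0 hc0))
  -- This keeps the base 2a - 1 nonnegative.
  have ha2 : 1 / 2 ≤ a := by
    rw [one_div, ← Real.rpow_neg_one]
    refine Real.rpow_le_rpow_of_exponent_le one_le_two ?_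
    nlinarith
  have hB : ∫⁻ y, ((W.ratio y ^ ρ : ℝ≥0) : ℝ≥0∞) ∂W.law 0 ≤ ENNReal.ofReal (2 * a - 1) := by
    rw [ENNReal.ofReal_sub _ zero_le_one, ENNReal.ofReal_one,
      ENNReal.ofReal_mul two_pos.le, ENNReal.ofReal_ofNat]
    refine ENNReal.le_sub_of_add_le_right ENNReal.one_ne_top ?_
    exact (W.lintegral_ratio_rpow_add_one_le hρ0.le hρ1).trans (by gcongr)
  set q : ℝ := 2 ^ (-(ρ * (δ / 2)))
  have hq1 : q < 1 :=
    Real.rpow_lt_one_of_one_lt_of_neg one_lt_two (neg_neg_of_pos (by positivity))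
  have hlim : Tendsto (fun n : ℕ => (2 * a - 1) ^ ⌊(n : ℝ) * δ⌋₊ + 2 ^ ρ * (n * q ^ n)) atTop
      (𝓝 (0 + 2 ^ ρ * 0)) := by
    refine Tendsto.add ?_ (Tendsto.const_mul _
      (tendsto_self_mul_const_pow_of_lt_one (by positivity) hq1))
    exact (tendsto_pow_atTop_nhds_zero_of_lt_one (by linarith) (by linarith)).comp
      (tendsto_nat_floor_atTop.comp (tendsto_natCast_atTop_atTop.atTop_mul_const hδ))
  rw [mul_zero, add_zero] at hlim
  obtain ⟨N, hN⟩ := eventually_atTop.1 (hlim.eventually_le_const hε)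
  refine ⟨N, fun n hn k hk hkn hkC => ?_⟩
  have hkn' : (k : ℝ) ≤ n := by exact_mod_cast hkn
  have hbound := (W.sum_wordLaw_confusion_le _ (isProfile_wideFirstProfile hk hkn).2 hρ0.le
    hρ1).trans (mul_le_mul_right (sum_union_bound_wideFirstProfile_le hk hkn hρ0.le hc1 hg
      (by linarith) (by linarith) hB) _)
  have hX : (2 * a - 1) ^ (n - k + 1) + k * (2 : ℝ) ^ (ρ * (k - c * n)) ≤ ε := by
    refine le_trans ?_ (hN n hn)
    refine add_le_add ?_ ?_
    · refine pow_le_pow_of_le_one (by linarith) (by linarith) ?_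
      -- The +1 in the first width offsets the rounding of `k`, and C ≤ 1 leaves n - k + 1 ≥ nδ.
      refine Nat.floor_le_of_le ?_
      rw [Nat.cast_add, Nat.cast_sub hkn, Nat.cast_one]
      have : (n : ℝ) * C ≤ n * 1 := mul_le_mul_of_nonneg_left hC1 (Nat.cast_nonneg n)
      linarith
    · have hexp : (2 : ℝ) ^ (ρ * (k - c * n)) ≤ 2 ^ ρ * q ^ n := by
        rw [← Real.rpow_mul_natCast two_pos.le, ← Real.rpow_add two_pos]
        refine Real.rpow_le_rpow_of_exponent_le one_le_two ?_
        rw [show ρ + -(ρ * (δ / 2)) * (n : ℝ) = ρ * (1 - δ / 2 * n) by ring]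
        refine mul_le_mul_of_nonneg_left ?_ hρ0.le
        simp only [c]
        linarith
      calc (k : ℝ) * (2 : ℝ) ^ (ρ * (k - c * n)) ≤ n * (2 ^ ρ * q ^ n) := by gcongr
        _ = _ := by ring
  have hbound' := hbound.trans (mul_le_mul_right (ENNReal.ofReal_le_ofReal hX) _)
  have := ENNReal.toReal_mono
    (ENNReal.mul_ne_top (ENNReal.natCast_ne_top _) ENNReal.ofReal_ne_top) hbound'
  rwa [ENNReal.toReal_sum fun G _ => measure_ne_top _ _, ENNReal.toReal_mul,
    ENNReal.toReal_natCast, ENNReal.toReal_ofReal hε.le] at this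

end BIOSChannel

theorem theorem2 {Y : Type*} [MeasurableSpace Y] (W : BIOSChannel Y) (ε δ : ℝ)
    (hε : 0 < ε) (hδ : 0 < δ) (hδC : δ < W.capacity) :
    ∃ nT : ℕ, ∀ n : ℕ, nT ≤ n → ∀ k : ℕ, k = ⌈(n : ℝ) * (W.capacity - δ)⌉₊ →
      0 < k ∧ k < n ∧
      W.capacity - δ ≤ (k : ℝ) / (n : ℝ) ∧ (k : ℝ) / (n : ℝ) < W.capacity ∧
      ∃ w : Fin k → ℕ, IsProfile n w ∧
        -- some staircase generator matrix is good under every ML decoder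
        (∃ G : Matrix (Fin k) (Fin n) (ZMod 2), IsStaircase w G ∧
          ∀ dec : (Fin n → Y) → (Fin k → ZMod 2), W.IsMLDecoder G dec → W.FER G dec ≤ ε) ∧
        -- and the random staircase code of this profile is good on average
        (∀ dec : Matrix (Fin k) (Fin n) (ZMod 2) → (Fin n → Y) → (Fin k → ZMod 2),
          (∀ G, IsStaircase w G → W.IsMLDecoder G (dec G)) → W.avgFER w dec ≤ ε) := by
  obtain ⟨N, hN⟩ := W.exists_sum_confusion_wideFirstProfile_le hε hδ hδC
  -- The second bound gives nδ ≥ 1, so rounding up keeps `k` below nC; its +1 makes n > 0 explicit.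
  refine ⟨max N (⌈1 / δ⌉₊ + 1), fun n hn k hkdef => ?_⟩
  have hC1 := W.capacity_le_one
  have hR : 0 < W.capacity - δ := sub_pos.2 hδC
  have hn1 : 0 < n := by have := le_of_max_le_right hn; omega
  have hn0 : (0 : ℝ) < n := by exact_mod_cast hn1
  have hnδ : 1 ≤ (n : ℝ) * δ := by
    rw [← div_le_iff₀ hδ]
    refine (Nat.le_ceil _).trans ?_
    exact_mod_cast (Nat.le_succ _).trans (le_of_max_le_right hn)
  have hkl : (n : ℝ) * (W.capacity - δ) ≤ k := hkdef ▸ Nat.le_ceil _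
  have hku : (k : ℝ) < n * (W.capacity - δ) + 1 := hkdef ▸ Nat.ceil_lt_add_one (by positivity)
  have hk0 : 0 < k := hkdef ▸ Nat.ceil_pos.2 (by positivity)
  have hkC : (k : ℝ) < W.capacity * n := by linarith
  have hkn : k < n := by
    have : (k : ℝ) < n := hkC.trans_le (mul_le_of_le_one_left hn0.le hC1)
    exact_mod_cast this
  have hsum := hN n (le_of_max_le_left hn) k hk0 hkn.le hku.le
  have hne := staircaseEnsemble_nonempty n (wideFirstProfile k n)
  refine ⟨hk0, hkn, (le_div_iff₀ hn0).2 (by linarith), (div_lt_iff₀ hn0).2 hkC,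
    wideFirstProfile k n, isProfile_wideFirstProfile hk0 hkn.le, ?_, fun dec hdec => ?_⟩
  -- Averaging is applied to the confusion probability, not to the error rate, so one `G` serves all
  -- decoders.
  · obtain ⟨G, hG, hGε⟩ := Finset.exists_le_of_sum_le hne
      (f := fun G => (W.wordLaw 0).real (W.confusion G)) (g := fun _ => ε)
      (by simpa using hsum)
    exact ⟨G, mem_staircaseEnsemble.1 hG, fun dec hdec => (W.FER_le_confusion hdec).trans hGε⟩
  · rw [BIOSChannel.avgFER, div_le_iff₀ (by exact_mod_cast hne.card_pos), mul_comm]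
    exact (Finset.sum_le_sum fun G hG =>
      W.FER_le_confusion (hdec G (mem_staircaseEnsemble.1 hG))).trans hsum
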